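/- Let $T>0$, and let $S_T$ be a non-negative integrable random variable on a probability space $(\Omega,\mathcal F,\mathbb P)$ with $S_0:=\mathbb E[S_T]>0$. Let $F(K):=\mathbb P(S_T\le K)$, let $N$ be the standard Gaussian cumulative distribution function, and let $\mathsf p:=\mathbb P(S_T=0)$ and $\mathsf q:=N^{-1}(\mathsf p)$. For $K>0$ let $I(K)\in[0,\infty)$ be the implied volatility at strike $K$ and maturity $T$, that is, the unique $\sigma\ge 0$ with $\mathbb E[(S_T-K)^+]=C_{BS}(K,T;S_0,\sigma)$, where $C_{BS}(K,T;S_0,\sigma)=S_0N(d_1)-KN(d_2)$ with $d_{1,2}=\frac{\log(S_0/K)}{\sigma\sqrt T}\pm\frac{\sigma\sqrt T}{2}$ if $\sigma>0$, and $C_{BS}(K,T;S_0,0)=(S_0-K)^+$. Write $x=\log(K/S_0)$ for the log-moneyness, so that $x\to-\infty$ as $K\downarrow 0$. Assume $\mathsf p>0$ (note that $\mathsf p<1$ since $S_0>0$). (i) If $F(K)-F(0)=o(|\log K|^{-1/2})$ as $K\downarrow 0$, then $$I(K)=\sqrt{\frac{2|x|}{T}}+\frac{\mathsf q}{\sqrt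 T}+\xi(K)\qquad\text{as }K\downarrow 0,$$ where $\xi(K)=\frac{1}{\sqrt{2T|x|}}\left(\frac{\mathsf q^2}{2}+e^{\mathsf q^2/2}\,\tau(K)\right)$ and $\tau$ is a real function with $0\le\limsup_{K\downarrow 0}\tau(K)\le 1$. (ii) If $F(K)-F(0)=O(K^{\varepsilon})$ as $K\downarrow 0$ for some $\varepsilon>0$, then $$I(K)=\sqrt{\frac{2|x|}{T}}+\frac{\mathsf q}{\sqrt T}+\frac{\mathsf q^2}{2\sqrt{2T|x|}}+\Phi(K)\qquad\text{as }K\downarrow 0,$$ where $\limsup_{K\downarrow 0}\sqrt{2T|x|}\,|\Phi(K)|\le 1$. When $S_0=1$ one has $|x|=|\log K|$. -/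

import Mathlib

open MeasureTheory ProbabilityTheory Filter Topology Asymptotics

namespace MassAtZero

noncomputable section

/-- The standard Gaussian cumulative distribution function `N`. -/
def stdNormalCDF (d : ℝ) : ℝ := cdf (gaussianReal 0 1) d

/-- The inverse `N⁻¹` of the standard Gaussian cdf (meaningful on `(0, 1)`, the range of `N`,
which is injective). -/
def stdNormalQuantile (p : ℝ) : ℝ := Function.invFun stdNormalCDF p

/-- `d₁ = log (S₀ / K) / (σ √T) + σ √T / 2`. -/
def d₁ (K T S₀ σ : ℝ) : ℝ :=
  Real.log (S₀ / K) / (σ * Real.sqrt T) + σ * Real.sqrt T / 2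

/-- `d₂ = log (S₀ / K) / (σ √T) - σ √T / 2`. -/
def d₂ (K T S₀ σ : ℝ) : ℝ :=
  Real.log (S₀ / K) / (σ * Real.sqrt T) - σ * Real.sqrt T / 2

/-- The Black-Scholes Call price with zero interest rate, spot `S₀`, strike `K`, maturity `T` and
volatility `σ ≥ 0`. -/
def bsCall (K T S₀ σ : ℝ) : ℝ :=
  if 0 < σ then S₀ * stdNormalCDF (d₁ K T S₀ σ) - K * stdNormalCDF (d₂ K T S₀ σ)
  else max (S₀ - K) 0

variable {Ω : Type*} [MeasurableSpace Ω]

/-- The price `C(K) = E[(S_T - K)⁺]` of the Call option with strike `K`. -/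
def callPrice (μ : Measure Ω) (S : Ω → ℝ) (K : ℝ) : ℝ := ∫ ω, max (S ω - K) 0 ∂μ

/-- The spot price `S₀ = E[S_T]`. -/
def spot (μ : Measure Ω) (S : Ω → ℝ) : ℝ := ∫ ω, S ω ∂μ

/-- The distribution function `F(K) = P(S_T ≤ K)`. -/
def distFun (μ : Measure Ω) (S : Ω → ℝ) (K : ℝ) : ℝ := μ.real {ω | S ω ≤ K}

/-- The mass at zero `P(S_T = 0)`. -/
def massAtZero (μ : Measure Ω) (S : Ω → ℝ) : ℝ := μ.real {ω | S ω = 0}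

/-- The implied volatility at strike `K` and maturity `T`: the solution `σ ∈ [0, ∞)` of
`C(K) = C_BS(K, T; S₀, σ)`, which for `K, T > 0` is unique because the Black-Scholes Call price is
strictly increasing in `σ ≥ 0`. -/
def impliedVol (μ : Measure Ω) (S : Ω → ℝ) (T K : ℝ) : ℝ :=
  Classical.epsilon fun σ : ℝ => 0 ≤ σ ∧ callPrice μ S K = bsCall K T (spot μ S) σ

end

end MassAtZero

/-! Put-call parity turns the Call price into the normalised Put `r = E[(K - S)⁺]/K`, and `p ≤ r ≤
F(K)`. With `L = log (S₀/K) = |x|` and `w = -d₂`, one has `d₁ = √(w² + 2L)`, so the defining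
equation of the implied volatility reads `N(w) = r + e^L N(-d₁)`. Since `e^L φ(d₁) = φ(w)`, the last
term is `φ(w)` times the Mills ratio at `d₁`, asymptotically `φ(q)/√(2L)`. If `r - p = o(L^{-1/2})`,
then `w → q` and `w - q ~ 1/√(2L)` (`tendsto_sqrt_mul_sub`).

As `σ√T = d₁ - d₂ = w + √(w² + 2L)`, expanding the root gives `σ√T = √(2L) + q + (1 + q²/2 +
o(1))/√(2L)` (`tendsto_impliedVol`). Both parts follow, with true limits: `τ → e^{-q²/2}` and
`√(2T|x|) |Φ| → 1`. -/

namespace MassAtZero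

/-! ### Gaussian density, distribution function and Mills ratio -/

/-- The standard Gaussian density. -/
noncomputable def stdNormalPDF (x : ℝ) : ℝ := gaussianPDFReal 0 1 x

theorem stdNormalPDF_eq (x : ℝ) :
    stdNormalPDF x = (Real.sqrt (2 * Real.pi))⁻¹ * Real.exp (-x ^ 2 / 2) := by
  simp [stdNormalPDF, gaussianPDFReal]

theorem stdNormalPDF_pos (x : ℝ) : 0 < stdNormalPDF x :=
  gaussianPDFReal_pos 0 1 x one_ne_zero

theorem stdNormalPDF_neg (x : ℝ) : stdNormalPDF (-x) = stdNormalPDF x := by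
  simp [stdNormalPDF_eq]

theorem stdNormalPDF_le_one (x : ℝ) : stdNormalPDF x ≤ 1 := by
  rw [stdNormalPDF_eq]
  refine mul_le_one₀ (inv_le_one_of_one_le₀ ?_) (Real.exp_nonneg _) ?_
  · rw [Real.one_le_sqrt]
    nlinarith [Real.two_le_pi]
  · rw [Real.exp_le_one_iff]
    nlinarith [sq_nonneg x]

theorem hasDerivAt_stdNormalPDF (x : ℝ) :
    HasDerivAt stdNormalPDF (-x * stdNormalPDF x) x := by
  have h : HasDerivAt (fun x : ℝ => (Real.sqrt (2 * Real.pi))⁻¹ * Real.exp (-x ^ 2 / 2))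
      ((Real.sqrt (2 * Real.pi))⁻¹ * (Real.exp (-x ^ 2 / 2) * (-(2 * x) / 2))) x := by
    have h1 : HasDerivAt (fun x : ℝ => -x ^ 2 / 2) (-(2 * x) / 2) x := by
      simpa using ((hasDerivAt_pow 2 x).neg.div_const 2)
    exact h1.exp.const_mul _
  rw [funext stdNormalPDF_eq]
  convert h using 1
  ring

theorem continuous_stdNormalPDF : Continuous stdNormalPDF :=
  continuous_iff_continuousAt.2 fun x => (hasDerivAt_stdNormalPDF x).continuousAt

theorem tendsto_stdNormalPDF_atTop : Tendsto stdNormalPDF atTop (𝓝 0) := by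
  rw [funext stdNormalPDF_eq, ← mul_zero (Real.sqrt (2 * Real.pi))⁻¹]
  refine Tendsto.const_mul _ (Real.tendsto_exp_atBot.comp ?_)
  refine (tendsto_neg_atTop_atBot.comp (tendsto_pow_atTop two_ne_zero)).atBot_div_const two_pos

theorem stdNormalCDF_eq_integral (x : ℝ) :
    stdNormalCDF x = ∫ t in Set.Iic x, stdNormalPDF t := by
  rw [stdNormalCDF, cdf_eq_real, measureReal_def,
    gaussianReal_apply_eq_integral 0 one_ne_zero, ENNReal.toReal_ofReal]
  · rfl
  · exact setIntegral_nonneg measurableSet_Iic fun t _ => gaussianPDFReal_nonneg 0 1 t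

theorem hasDerivAt_stdNormalCDF (x : ℝ) : HasDerivAt stdNormalCDF (stdNormalPDF x) x := by
  have hint : Integrable stdNormalPDF := integrable_gaussianPDFReal 0 1
  have h : ∀ y, stdNormalCDF y = stdNormalCDF 0 + ∫ t in (0 : ℝ)..y, stdNormalPDF t := fun y => by
    rw [stdNormalCDF_eq_integral, stdNormalCDF_eq_integral,
      ← intervalIntegral.integral_Iic_sub_Iic hint.integrableOn hint.integrableOn]
    ring
  rw [funext h]
  exact (intervalIntegral.integral_hasDerivAt_right hint.intervalIntegrable
    (continuous_stdNormalPDF.stronglyMeasurableAtFilter _ _)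
    continuous_stdNormalPDF.continuousAt).const_add _

theorem continuous_stdNormalCDF : Continuous stdNormalCDF :=
  continuous_iff_continuousAt.2 fun x => (hasDerivAt_stdNormalCDF x).continuousAt

theorem strictMono_stdNormalCDF : StrictMono stdNormalCDF :=
  strictMono_of_deriv_pos fun x => by
    rw [(hasDerivAt_stdNormalCDF x).deriv]; exact stdNormalPDF_pos x

theorem tendsto_stdNormalCDF_atTop : Tendsto stdNormalCDF atTop (𝓝 1) := tendsto_cdf_atTop _

theorem tendsto_stdNormalCDF_atBot : Tendsto stdNormalCDF atBot (𝓝 0) := tendsto_cdf_atBot _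

theorem stdNormalCDF_neg (x : ℝ) : stdNormalCDF (-x) = 1 - stdNormalCDF x := by
  have hd : ∀ y, HasDerivAt (fun y => stdNormalCDF y + stdNormalCDF (-y)) 0 y := fun y => by
    have h := (hasDerivAt_stdNormalCDF y).add
      ((hasDerivAt_stdNormalCDF (-y)).comp y (hasDerivAt_neg y))
    rw [stdNormalPDF_neg] at h
    simpa using! h
  have hc : ∀ y, stdNormalCDF y + stdNormalCDF (-y) = stdNormalCDF x + stdNormalCDF (-x) :=
    fun y => is_const_of_deriv_eq_zero (fun z => (hd z).differentiableAt)
      (fun z => (hd z).deriv) y x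
  have hlim : Tendsto (fun y => stdNormalCDF y + stdNormalCDF (-y)) atTop (𝓝 (1 + 0)) :=
    tendsto_stdNormalCDF_atTop.add (tendsto_stdNormalCDF_atBot.comp tendsto_neg_atTop_atBot)
  rw [funext hc] at hlim
  linarith [tendsto_nhds_unique hlim tendsto_const_nhds]

theorem stdNormalCDF_stdNormalQuantile {p : ℝ} (h0 : 0 < p) (h1 : p < 1) :
    stdNormalCDF (stdNormalQuantile p) = p := by
  refine Function.invFun_eq (f := stdNormalCDF) ?_
  obtain ⟨a, ha⟩ := (tendsto_stdNormalCDF_atBot.eventually_lt_const h0).exists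
  obtain ⟨b, hb⟩ := (tendsto_stdNormalCDF_atTop.eventually_const_lt h1).exists
  exact mem_range_of_exists_le_of_exists_ge continuous_stdNormalCDF ⟨a, ha.le⟩ ⟨b, hb.le⟩

/-- First order asymptotics of the Mills ratio of the standard Gaussian law. -/
theorem tendsto_mul_millsRatio :
    Tendsto (fun z => z * (stdNormalCDF (-z) / stdNormalPDF z)) atTop (𝓝 1) := by
  have h : Tendsto (fun z => stdNormalCDF (-z) / (stdNormalPDF z / z)) atTop (𝓝 1) := by
    -- The quotient of derivatives is `1 / (1 + z⁻²)`.
    refine HasDerivAt.lhopital_zero_atTop_on_Ioi (a := 0) (f' := fun z => -stdNormalPDF z)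
      (g' := fun z => (-z * stdNormalPDF z * z - stdNormalPDF z * 1) / z ^ 2) ?_ ?_ ?_ ?_ ?_ ?_
    · intro z _
      have h := (hasDerivAt_stdNormalCDF (-z)).comp z (hasDerivAt_neg z)
      rw [stdNormalPDF_neg] at h
      simpa using! h
    · intro z hz
      exact (hasDerivAt_stdNormalPDF z).div (hasDerivAt_id z) (ne_of_gt hz)
    · intro z hz
      have hz : 0 < z := hz
      refine div_ne_zero (ne_of_lt ?_) (by positivity)
      nlinarith [stdNormalPDF_pos z, mul_pos (stdNormalPDF_pos z) (mul_pos hz hz)]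
    · exact tendsto_stdNormalCDF_atBot.comp tendsto_neg_atTop_atBot
    · exact tendsto_stdNormalPDF_atTop.div_atTop tendsto_id
    · have h1 : Tendsto (fun z : ℝ => 1 / (1 + (z ^ 2)⁻¹)) atTop (𝓝 (1 / (1 + 0))) :=
        tendsto_const_nhds.div (tendsto_const_nhds.add
          (tendsto_inv_atTop_zero.comp (tendsto_pow_atTop two_ne_zero))) (by norm_num)
      rw [add_zero, div_one] at h1
      refine h1.congr' ?_
      filter_upwards [eventually_gt_atTop 0] with z hz
      have hφ := (stdNormalPDF_pos z).ne'
      have h2 : (-z * stdNormalPDF z * z - stdNormalPDF z * 1)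
        = -(stdNormalPDF z * (z ^ 2 + 1)) := by ring
      rw [h2]
      field_simp
  refine h.congr' ?_
  filter_upwards [eventually_gt_atTop 0] with z hz
  have hφ := (stdNormalPDF_pos z).ne'
  field_simp

/-! ### Asymptotics of the equation for `w = -d₂` -/

theorem tendsto_of_tendsto_stdNormalCDF {ι : Type*} {l : Filter ι} {w : ι → ℝ} {q : ℝ}
    (h : Tendsto (fun i => stdNormalCDF (w i)) l (𝓝 (stdNormalCDF q))) : Tendsto w l (𝓝 q) := by
  rw [tendsto_order] at h ⊢
  refine ⟨fun a ha => ?_, fun a ha => ?_⟩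
  · exact (h.1 _ (strictMono_stdNormalCDF ha)).mono fun i => strictMono_stdNormalCDF.lt_iff_lt.1
  · exact (h.2 _ (strictMono_stdNormalCDF ha)).mono fun i => strictMono_stdNormalCDF.lt_iff_lt.1

/-- The exploding factor `e^L` is exactly the ratio `φ(w)/φ(d)` when `d² = w² + 2L`; what remains is
a bounded density times a Mills ratio. -/
theorem exp_mul_stdNormalCDF_neg_sqrt {L : ℝ} (hL : 0 < L) (w : ℝ) :
    Real.exp L * stdNormalCDF (-Real.sqrt (w ^ 2 + 2 * L)) =
      stdNormalPDF w * (stdNormalCDF (-Real.sqrt (w ^ 2 + 2 * L)) /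
        stdNormalPDF (Real.sqrt (w ^ 2 + 2 * L))) := by
  have h : stdNormalPDF w = Real.exp L * stdNormalPDF (Real.sqrt (w ^ 2 + 2 * L)) := by
    rw [stdNormalPDF_eq, stdNormalPDF_eq, Real.sq_sqrt (by positivity), mul_left_comm,
      ← Real.exp_add]
    congr 2
    ring
  have hφ := (stdNormalPDF_pos (Real.sqrt (w ^ 2 + 2 * L))).ne'
  rw [h]
  field_simp

/-- First order asymptotics of the solutions `w` of `N(w) = r + e^L N(-√(w² + 2L))` as `L → ∞`
and `r → N(q)` faster than `L^{-1/2}`. -/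
theorem tendsto_sqrt_mul_sub {ι : Type*} {l : Filter ι} {L w r : ι → ℝ} {q : ℝ}
    (hL : Tendsto L l atTop)
    (heq : ∀ᶠ i in l, stdNormalCDF (w i) =
      r i + Real.exp (L i) * stdNormalCDF (-Real.sqrt (w i ^ 2 + 2 * L i)))
    (hr : Tendsto (fun i => Real.sqrt (2 * L i) * (r i - stdNormalCDF q)) l (𝓝 0)) :
    Tendsto w l (𝓝 q) ∧ Tendsto (fun i => Real.sqrt (2 * L i) * (w i - q)) l (𝓝 1) := by
  have hs : Tendsto (fun i => Real.sqrt (2 * L i)) l atTop :=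
    Real.tendsto_sqrt_atTop.comp (hL.const_mul_atTop two_pos)
  -- No bound on `w` is known yet; `d ≥ √(2L)` suffices.
  have hd : Tendsto (fun i => Real.sqrt (w i ^ 2 + 2 * L i)) l atTop :=
    tendsto_atTop_mono (fun i => Real.sqrt_le_sqrt (by nlinarith [sq_nonneg (w i)])) hs
  have hM := tendsto_mul_millsRatio.comp hd
  have hLpos := hL.eventually_gt_atTop 0
  have heq' : ∀ᶠ i in l, stdNormalCDF (w i) = r i + stdNormalPDF (w i) *
      (stdNormalCDF (-Real.sqrt (w i ^ 2 + 2 * L i)) /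
        stdNormalPDF (Real.sqrt (w i ^ 2 + 2 * L i))) := by
    filter_upwards [heq, hLpos] with i h hi
    rw [h, exp_mul_stdNormalCDF_neg_sqrt hi]
  have hm : Tendsto (fun i => stdNormalCDF (-Real.sqrt (w i ^ 2 + 2 * L i)) /
      stdNormalPDF (Real.sqrt (w i ^ 2 + 2 * L i))) l (𝓝 0) := by
    refine (hM.div_atTop hd).congr' ?_
    filter_upwards [hd.eventually_gt_atTop 0] with i hi
    simp only [Function.comp]
    field_simp
  have hr0 : Tendsto r l (𝓝 (stdNormalCDF q)) := by
    have h : Tendsto (fun i => r i - stdNormalCDF q) l (𝓝 0) := by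
      refine (hr.div_atTop hs).congr' ?_
      filter_upwards [hs.eventually_gt_atTop 0] with i hi
      field_simp
    simpa using h.add_const (stdNormalCDF q)
  have hw : Tendsto w l (𝓝 q) := by
    refine tendsto_of_tendsto_stdNormalCDF ?_
    have h := hr0.add (bdd_le_mul_tendsto_zero' 1
      (Eventually.of_forall fun i => by
        rw [abs_of_pos (stdNormalPDF_pos (w i))]; exact stdNormalPDF_le_one (w i)) hm)
    rw [add_zero] at h
    refine h.congr' ?_
    filter_upwards [heq'] with i hi using hi.symm
  refine ⟨hw, ?_⟩
  have hratio : Tendsto (fun i => Real.sqrt (2 * L i) / Real.sqrt (w i ^ 2 + 2 * L i)) l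
      (𝓝 1) := by
    have h : Tendsto (fun i => Real.sqrt (1 / (w i ^ 2 / (2 * L i) + 1))) l
        (𝓝 (Real.sqrt (1 / (0 + 1)))) :=
      (tendsto_const_nhds.div (((hw.pow 2).div_atTop (hL.const_mul_atTop two_pos)).add_const 1)
        (by norm_num)).sqrt
    simp only [zero_add, div_one, Real.sqrt_one] at h
    refine h.congr' ?_
    filter_upwards [hLpos] with i hi
    rw [← Real.sqrt_div (by positivity)]
    congr 1
    field_simp
  have hφ := (continuous_stdNormalPDF.tendsto q).comp hw
  have hprod : Tendsto (fun i => Real.sqrt (2 * L i) * (stdNormalCDF (w i) - stdNormalCDF q)) l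
      (𝓝 (0 + stdNormalPDF q * (1 * 1))) := by
    refine (hr.add (hφ.mul (hratio.mul hM))).congr' ?_
    filter_upwards [heq', hd.eventually_gt_atTop 0] with i h hi
    simp only [Function.comp]
    rw [h]
    have := (stdNormalPDF_pos (Real.sqrt (w i ^ 2 + 2 * L i))).ne'
    field_simp
    ring
  -- `dslope` equals the derivative on the diagonal, so indices with `w = q` need no separate
  -- treatment.
  have hslope : Tendsto (fun i => dslope stdNormalCDF q (w i)) l (𝓝 (stdNormalPDF q)) := by
    have h : ContinuousAt (dslope stdNormalCDF q) q :=
      continuousAt_dslope_same.2 (hasDerivAt_stdNormalCDF q).differentiableAt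
    have h2 := h.tendsto.comp hw
    rwa [dslope_same, (hasDerivAt_stdNormalCDF q).deriv] at h2
  have hq := (stdNormalPDF_pos q).ne'
  have hfin := hprod.div hslope hq
  rw [show (0 + stdNormalPDF q * (1 * 1)) / stdNormalPDF q = 1 by field_simp; ring] at hfin
  refine hfin.congr' ?_
  filter_upwards [hslope.eventually_ne hq] with i hi
  have h := sub_smul_dslope stdNormalCDF q (w i)
  simp only [smul_eq_mul] at h
  simp only [Pi.div_apply]
  rw [← h]
  field_simp

/-- Rationalising, `√(2L) (√(w² + 2L) - √(2L)) = w² / (√(w²/(2L) + 1) + 1) → q²/2`; the other `1`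
comes from `w - q`. -/
theorem tendsto_sqrt_mul_add_sqrt {ι : Type*} {l : Filter ι} {L w : ι → ℝ} {q : ℝ}
    (hL : Tendsto L l atTop) (hw : Tendsto w l (𝓝 q))
    (h : Tendsto (fun i => Real.sqrt (2 * L i) * (w i - q)) l (𝓝 1)) :
    Tendsto (fun i => Real.sqrt (2 * L i) *
      (w i + Real.sqrt (w i ^ 2 + 2 * L i) - Real.sqrt (2 * L i) - q)) l
      (𝓝 (1 + q ^ 2 / 2)) := by
  have hLpos := hL.eventually_gt_atTop 0
  have h1 : Tendsto (fun i => w i ^ 2 / (Real.sqrt (w i ^ 2 / (2 * L i) + 1) + 1)) l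
      (𝓝 (q ^ 2 / (Real.sqrt (0 + 1) + 1))) :=
    (hw.pow 2).div ((((hw.pow 2).div_atTop (hL.const_mul_atTop two_pos)).add_const 1).sqrt.add_const
      1) (by positivity)
  rw [zero_add, Real.sqrt_one, one_add_one_eq_two] at h1
  refine (h.add h1).congr' ?_
  filter_upwards [hLpos] with i hi
  have hs : 0 < Real.sqrt (2 * L i) := by positivity
  have e : Real.sqrt (w i ^ 2 / (2 * L i) + 1) =
      Real.sqrt (w i ^ 2 + 2 * L i) / Real.sqrt (2 * L i) := by
    rw [← Real.sqrt_div (by positivity)]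
    congr 1
    field_simp
  have h2 : Real.sqrt (w i ^ 2 + 2 * L i) ^ 2 = w i ^ 2 + 2 * L i := Real.sq_sqrt (by positivity)
  have h3 : Real.sqrt (2 * L i) ^ 2 = 2 * L i := Real.sq_sqrt (by positivity)
  have h4 := Real.sqrt_nonneg (w i ^ 2 + 2 * L i)
  rw [e]
  generalize Real.sqrt (w i ^ 2 + 2 * L i) = d at *
  generalize Real.sqrt (2 * L i) = s at *
  have h5 : w i ^ 2 = d ^ 2 - s ^ 2 := by linarith
  have h6 : d + s ≠ 0 := by positivity
  rw [h5]
  field_simp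
  ring

/-! ### The Black-Scholes price in terms of `d₂` -/

theorem d₁_sq_eq {K T S₀ σ : ℝ} (h : σ * Real.sqrt T ≠ 0) :
    d₁ K T S₀ σ ^ 2 = d₂ K T S₀ σ ^ 2 + 2 * Real.log (S₀ / K) := by
  unfold d₁ d₂
  generalize σ * Real.sqrt T = v at *
  field_simp
  ring

theorem d₁_eq_sqrt {K T S₀ σ : ℝ} (hT : 0 < T) (hσ : 0 < σ) (hL : 0 < Real.log (S₀ / K)) :
    d₁ K T S₀ σ = Real.sqrt (d₂ K T S₀ σ ^ 2 + 2 * Real.log (S₀ / K)) := by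
  rw [← d₁_sq_eq (by positivity), Real.sqrt_sq]
  unfold d₁
  positivity

theorem d₁_sub_d₂ (K T S₀ σ : ℝ) : d₁ K T S₀ σ - d₂ K T S₀ σ = σ * Real.sqrt T := by
  unfold d₁ d₂; ring

/-- The normalised Black-Scholes Put price, obtained from the Call price by Put-Call parity. -/
theorem bsCall_parity {K T S₀ σ : ℝ} (hK : 0 < K) (hS₀ : 0 < S₀) (hσ : 0 < σ) :
    (bsCall K T S₀ σ - S₀ + K) / K =
      stdNormalCDF (-d₂ K T S₀ σ) -
        Real.exp (Real.log (S₀ / K)) * stdNormalCDF (-d₁ K T S₀ σ) := by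
  rw [bsCall, if_pos hσ, Real.exp_log (by positivity), stdNormalCDF_neg, stdNormalCDF_neg]
  field_simp
  ring

/-- Existence of a positive volatility for out-of-the-money Put prices strictly between `0`
and `K`. -/
theorem exists_bsCall_eq {K T S₀ C : ℝ} (hT : 0 < T) (hK : 0 < K) (hKS : K < S₀)
    (h0 : 0 < (C - S₀ + K) / K) (h1 : (C - S₀ + K) / K < 1) :
    ∃ σ : ℝ, 0 < σ ∧ C = bsCall K T S₀ σ := by
  have hS₀ : 0 < S₀ := hK.trans hKS
  have hL : 0 < Real.log (S₀ / K) := Real.log_pos ((one_lt_div hK).2 hKS)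
  set L := Real.log (S₀ / K) with hLdef
  set h : ℝ → ℝ := fun w =>
    stdNormalCDF w - Real.exp L * stdNormalCDF (-Real.sqrt (w ^ 2 + 2 * L)) with hh
  have hc : Continuous h := by
    have := continuous_stdNormalCDF
    fun_prop
  -- The correction term vanishes as soon as `|w| → ∞`, so `h` runs from `0` to `1` and the
  -- intermediate value theorem applies.
  have hlim : ∀ (l : Filter ℝ) (a : ℝ), Tendsto stdNormalCDF l (𝓝 a) →
      Tendsto (fun w : ℝ => |w|) l atTop → Tendsto h l (𝓝 a) := by
    intro l a ha habs
    have hd : Tendsto (fun w : ℝ => Real.sqrt (w ^ 2 + 2 * L)) l atTop :=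
      tendsto_atTop_mono (fun w => Real.abs_le_sqrt (by linarith)) habs
    simpa using ha.sub ((tendsto_stdNormalCDF_atBot.comp
      (tendsto_neg_atTop_atBot.comp hd)).const_mul (Real.exp L))
  obtain ⟨a, ha⟩ := ((hlim _ _ tendsto_stdNormalCDF_atBot
    tendsto_abs_atBot_atTop).eventually_lt_const h0).exists
  obtain ⟨b, hb⟩ := ((hlim _ _ tendsto_stdNormalCDF_atTop
    tendsto_abs_atTop_atTop).eventually_const_lt h1).exists
  obtain ⟨w, hw⟩ := mem_range_of_exists_le_of_exists_ge hc ⟨a, ha.le⟩ ⟨b, hb.le⟩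
  have hd2 : Real.sqrt (w ^ 2 + 2 * L) ^ 2 = w ^ 2 + 2 * L := Real.sq_sqrt (by positivity)
  have hdw : 0 < w + Real.sqrt (w ^ 2 + 2 * L) := by
    have h2 : |w| < Real.sqrt (w ^ 2 + 2 * L) := by
      rw [← Real.sqrt_sq_eq_abs]
      exact Real.sqrt_lt_sqrt (sq_nonneg w) (by linarith)
    linarith [neg_abs_le w]
  have hsT : 0 < Real.sqrt T := Real.sqrt_pos.2 hT
  have hσ : 0 < (w + Real.sqrt (w ^ 2 + 2 * L)) / Real.sqrt T := div_pos hdw hsT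
  -- The volatility solves `d₁ - d₂ = σ√T` with `d₂ = -w`.
  have e2 : d₂ K T S₀ ((w + Real.sqrt (w ^ 2 + 2 * L)) / Real.sqrt T) = -w := by
    rw [d₂, ← hLdef, div_mul_cancel₀ _ hsT.ne']
    generalize Real.sqrt (w ^ 2 + 2 * L) = d at *
    have : L = (d ^ 2 - w ^ 2) / 2 := by linarith
    rw [this]
    field_simp
    ring
  refine ⟨_, hσ, ?_⟩
  have hb := bsCall_parity (T := T) hK hS₀ hσ
  rw [d₁_eq_sqrt hT hσ hL, e2, neg_neg, neg_sq] at hb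
  have h3 := hb.trans hw
  rw [div_left_inj' hK.ne'] at h3
  linarith

/-! ### Put prices and the mass at zero -/

variable {Ω : Type*} [MeasurableSpace Ω] {μ : Measure Ω} {S : Ω → ℝ}

theorem impliedVol_spec {T K : ℝ} (hT : 0 < T) (hK : 0 < K) (hKS : K < spot μ S)
    (h0 : 0 < (callPrice μ S K - spot μ S + K) / K)
    (h1 : (callPrice μ S K - spot μ S + K) / K < 1) :
    0 < impliedVol μ S T K ∧ callPrice μ S K = bsCall K T (spot μ S) (impliedVol μ S T K) := by
  obtain ⟨σ, hσ, hC⟩ := exists_bsCall_eq hT hK hKS h0 h1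
  have h : 0 ≤ impliedVol μ S T K ∧
      callPrice μ S K = bsCall K T (spot μ S) (impliedVol μ S T K) :=
    Classical.epsilon_spec
      (p := fun σ : ℝ => 0 ≤ σ ∧ callPrice μ S K = bsCall K T (spot μ S) σ) ⟨σ, hσ.le, hC⟩
  -- At `σ = 0` the Call is worth `S₀ - K`, making the Put worthless, against `h0`.
  refine ⟨lt_of_le_of_ne h.1 fun h2 => ?_, h.2⟩
  have h3 := h.2
  rw [← h2, bsCall, if_neg (lt_irrefl 0), max_eq_left (by linarith)] at h3
  rw [h3] at h0
  simp at h0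

theorem callPrice_parity [IsProbabilityMeasure μ] (hS : Integrable S μ) (K : ℝ) :
    callPrice μ S K - spot μ S + K = ∫ ω, max (K - S ω) 0 ∂μ := by
  have h1 : Integrable (fun ω => max (S ω - K) 0) μ := (hS.sub (integrable_const K)).pos_part
  have h2 : ∫ ω, (max (S ω - K) 0 - S ω + K) ∂μ = callPrice μ S K - spot μ S + K := by
    rw [integral_add (f := fun ω => max (S ω - K) 0 - S ω) (h1.sub hS) (integrable_const K),
      integral_sub h1 hS]
    simp [callPrice, spot]
  rw [← h2]
  refine integral_congr_ae (Eventually.of_forall fun ω => ?_)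
  simp only
  rcases le_total (S ω) K with h | h
  · rw [max_eq_right (by linarith), max_eq_left (by linarith)]; ring
  · rw [max_eq_left (by linarith), max_eq_right (by linarith)]; ring

theorem nullMeasurableSet_sublevel (hS : Integrable S μ) (K : ℝ) :
    NullMeasurableSet {ω | S ω ≤ K} μ :=
  nullMeasurableSet_le hS.aemeasurable aemeasurable_const

theorem distFun_zero (hS0 : ∀ᵐ ω ∂μ, 0 ≤ S ω) : distFun μ S 0 = massAtZero μ S := by
  refine measureReal_congr ?_
  filter_upwards [hS0] with ω h
  exact propext ⟨fun h' => le_antisymm h' h, fun h' => le_of_eq h'⟩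

/-- As `S ≥ 0`, the Put payoff is at most `K` on `{S ≤ K}` and vanishes elsewhere. With
`le_putPrice` this squeezes the normalised Put between `p` and `F(K)`. -/
theorem putPrice_le [IsProbabilityMeasure μ] (hS : Integrable S μ) (hS0 : ∀ᵐ ω ∂μ, 0 ≤ S ω)
    {K : ℝ} (hK : 0 < K) : ∫ ω, max (K - S ω) 0 ∂μ ≤ K * distFun μ S K := by
  have hm := nullMeasurableSet_sublevel hS K
  have h : ∫ ω, {ω | S ω ≤ K}.indicator (fun _ => K) ω ∂μ = K * distFun μ S K := by
    rw [integral_indicator₀ hm, setIntegral_const, smul_eq_mul, mul_comm, distFun]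
  rw [← h]
  refine integral_mono_ae ((integrable_const K).sub hS).pos_part
    ((integrable_const K).indicator₀ hm) ?_
  filter_upwards [hS0] with ω h0
  by_cases hω : S ω ≤ K
  · rw [Set.indicator_of_mem (by exact hω)]
    exact max_le (by linarith) hK.le
  · rw [Set.indicator_of_notMem (by exact hω)]
    exact max_le (by linarith) le_rfl

theorem le_putPrice [IsProbabilityMeasure μ] (hS : Integrable S μ) (hS0 : ∀ᵐ ω ∂μ, 0 ≤ S ω)
    (K : ℝ) : K * massAtZero μ S ≤ ∫ ω, max (K - S ω) 0 ∂μ := by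
  have hm := nullMeasurableSet_sublevel hS 0
  have h : ∫ ω, {ω | S ω ≤ 0}.indicator (fun _ => K) ω ∂μ = K * massAtZero μ S := by
    rw [integral_indicator₀ hm, setIntegral_const, smul_eq_mul, mul_comm, ← distFun_zero hS0,
      distFun]
  rw [← h]
  refine integral_mono_ae ((integrable_const K).indicator₀ hm)
    ((integrable_const K).sub hS).pos_part ?_
  filter_upwards with ω
  by_cases hω : S ω ≤ 0
  · rw [Set.indicator_of_mem (by exact hω)]
    exact le_max_of_le_left (by linarith)
  · rw [Set.indicator_of_notMem (by exact hω)]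
    exact le_max_right _ _

theorem massAtZero_lt_one [IsProbabilityMeasure μ] (hS : Integrable S μ)
    (hS0 : ∀ᵐ ω ∂μ, 0 ≤ S ω) (hpos : 0 < spot μ S) : massAtZero μ S < 1 := by
  refine lt_of_le_of_ne measureReal_le_one fun h => hpos.ne' ?_
  rw [← distFun_zero hS0, distFun, measureReal_def, ENNReal.toReal_eq_one_iff,
    ← mem_ae_iff_prob_eq_one₀ (nullMeasurableSet_sublevel hS 0)] at h
  refine integral_eq_zero_of_ae ?_
  filter_upwards [h, hS0] with ω h1 h2 using le_antisymm h1 h2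

/-! ### Asymptotics of the implied volatility -/

/-- If the distribution function is close enough to the mass at zero, then the implied volatility
is asymptotic to `√(2|x|/T) + q/√T + (1 + q²/2)/√(2T|x|)`. -/
theorem tendsto_impliedVol [IsProbabilityMeasure μ] {T q : ℝ} (hT : 0 < T)
    (hS : Integrable S μ) (hS0 : ∀ᵐ ω ∂μ, 0 ≤ S ω) (hpos : 0 < spot μ S)
    (hp : 0 < massAtZero μ S) (hq : q = stdNormalQuantile (massAtZero μ S))
    (ho : (fun K : ℝ => distFun μ S K - distFun μ S 0)
        =o[𝓝[>] (0 : ℝ)] (fun K : ℝ => |Real.log K| ^ (-(1 / 2) : ℝ))) :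
    Tendsto (fun K : ℝ => Real.sqrt (2 * T * |Real.log (K / spot μ S)|) *
      (impliedVol μ S T K - Real.sqrt (2 * |Real.log (K / spot μ S)| / T) - q / Real.sqrt T))
      (𝓝[>] 0) (𝓝 (1 + q ^ 2 / 2)) := by
  have hp1 := massAtZero_lt_one hS hS0 hpos
  have hNq : stdNormalCDF q = massAtZero μ S := by
    rw [hq, stdNormalCDF_stdNormalQuantile hp hp1]
  have hKpos : ∀ᶠ K : ℝ in 𝓝[>] 0, 0 < K := self_mem_nhdsWithin
  have hKS : ∀ᶠ K : ℝ in 𝓝[>] 0, K < spot μ S :=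
    nhdsWithin_le_nhds (eventually_lt_nhds hpos)
  have hlog : Tendsto (fun K : ℝ => -Real.log K) (𝓝[>] 0) atTop :=
    tendsto_neg_atBot_atTop.comp Real.tendsto_log_nhdsGT_zero
  set L : ℝ → ℝ := fun K => Real.log (spot μ S / K) with hLdef
  have hLeq : ∀ᶠ K : ℝ in 𝓝[>] 0, L K = Real.log (spot μ S) + -Real.log K := by
    filter_upwards [hKpos] with K hK
    rw [hLdef]
    simp only
    rw [Real.log_div hpos.ne' hK.ne', sub_eq_add_neg]
  have hL : Tendsto L (𝓝[>] 0) atTop :=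
    (tendsto_atTop_add_const_left _ (Real.log (spot μ S)) hlog).congr'
      (hLeq.mono fun K h => h.symm)
  set r : ℝ → ℝ := fun K => (callPrice μ S K - spot μ S + K) / K with hrdef
  have hrle : ∀ᶠ K : ℝ in 𝓝[>] 0, r K ≤ distFun μ S K := by
    filter_upwards [hKpos] with K hK
    rw [hrdef]
    simp only
    rw [div_le_iff₀ hK, callPrice_parity hS, mul_comm]
    exact putPrice_le hS hS0 hK
  have hrge : ∀ᶠ K : ℝ in 𝓝[>] 0, massAtZero μ S ≤ r K := by
    filter_upwards [hKpos] with K hK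
    rw [hrdef]
    simp only
    rw [le_div_iff₀ hK, callPrice_parity hS, mul_comm]
    exact le_putPrice hS hS0 K
  -- The hypothesis is scaled by `|log K|`, not by `L`; the two differ by the constant `log S₀`, so
  -- their ratio tends to `1`.
  have hδ : Tendsto (fun K => Real.sqrt (2 * L K) * (distFun μ S K - massAtZero μ S))
      (𝓝[>] 0) (𝓝 0) := by
    have h1 : Tendsto (fun K : ℝ => (distFun μ S K - distFun μ S 0) /
        |Real.log K| ^ (-(1 / 2) : ℝ)) (𝓝[>] 0) (𝓝 0) := ho.tendsto_div_nhds_zero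
    have h2 : Tendsto (fun K : ℝ => Real.sqrt (2 * (Real.log (spot μ S) / -Real.log K + 1)))
        (𝓝[>] 0) (𝓝 (Real.sqrt (2 * (0 + 1)))) :=
      (((tendsto_const_nhds.div_atTop hlog).add_const 1).const_mul 2).sqrt
    have h3 := h2.mul h1
    rw [mul_zero] at h3
    refine h3.congr' ?_
    filter_upwards [hLeq, hlog.eventually_gt_atTop 0] with K hLK hK
    rw [hLK, abs_of_neg (by linarith), Real.rpow_neg hK.le, ← Real.sqrt_eq_rpow, div_inv_eq_mul,
      distFun_zero hS0]
    have h4 : Real.sqrt (2 * (Real.log (spot μ S) + -Real.log K)) =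
        Real.sqrt (2 * (Real.log (spot μ S) / -Real.log K + 1)) * Real.sqrt (-Real.log K) := by
      rw [← Real.sqrt_mul' _ hK.le]
      congr 1
      have h5 : Real.log K ≠ 0 := (neg_pos.1 hK).ne
      field_simp
      ring
    rw [h4]
    ring
  have hr : Tendsto (fun K => Real.sqrt (2 * L K) * (r K - stdNormalCDF q)) (𝓝[>] 0) (𝓝 0) := by
    rw [hNq]
    refine tendsto_of_tendsto_of_tendsto_of_le_of_le' tendsto_const_nhds hδ ?_ ?_
    · filter_upwards [hrge] with K h
      exact mul_nonneg (Real.sqrt_nonneg _) (sub_nonneg.2 h)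
    · filter_upwards [hrle] with K h
      exact mul_le_mul_of_nonneg_left (by linarith) (Real.sqrt_nonneg _)
  -- Once `√(2L) ≥ 1`, `r - p` is at most its rescaled version, which is eventually below `1 - p`.
  have hr1 : ∀ᶠ K : ℝ in 𝓝[>] 0, r K < 1 := by
    filter_upwards [hr.eventually_lt_const (sub_pos.2 hp1), hL.eventually_ge_atTop 1, hrge]
      with K h1 h2 h3
    rw [hNq] at h1
    have h4 : 1 ≤ Real.sqrt (2 * L K) := Real.one_le_sqrt.2 (by linarith)
    nlinarith
  have hspec : ∀ᶠ K : ℝ in 𝓝[>] 0, 0 < impliedVol μ S T K ∧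
      callPrice μ S K = bsCall K T (spot μ S) (impliedVol μ S T K) := by
    filter_upwards [hKpos, hKS, hr1, hrge] with K h1 h2 h3 h4
    exact impliedVol_spec hT h1 h2 (hp.trans_le h4) h3
  set w : ℝ → ℝ := fun K => -d₂ K T (spot μ S) (impliedVol μ S T K) with hwdef
  have heq : ∀ᶠ K : ℝ in 𝓝[>] 0, stdNormalCDF (w K) =
      r K + Real.exp (L K) * stdNormalCDF (-Real.sqrt (w K ^ 2 + 2 * L K)) := by
    filter_upwards [hKpos, hspec, hL.eventually_gt_atTop 0] with K hK hσ hLK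
    have h := bsCall_parity (T := T) hK hpos hσ.1
    rw [d₁_eq_sqrt hT hσ.1 hLK, ← hσ.2] at h
    simp only [hrdef, hwdef, neg_sq]
    rw [h]
    ring
  obtain ⟨hw, hw1⟩ := tendsto_sqrt_mul_sub hL heq hr
  refine (tendsto_sqrt_mul_add_sqrt hL hw hw1).congr' ?_
  filter_upwards [hKpos, hspec, hL.eventually_gt_atTop 0] with K hK hσ hLK
  have habs : |Real.log (K / spot μ S)| = L K := by
    rw [← inv_div, Real.log_inv, abs_neg, abs_of_pos hLK]
  have hv := d₁_sub_d₂ K T (spot μ S) (impliedVol μ S T K)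
  rw [d₁_eq_sqrt hT hσ.1 hLK] at hv
  have hsT : 0 < Real.sqrt T := Real.sqrt_pos.2 hT
  rw [habs, Real.sqrt_div (by positivity), mul_right_comm, Real.sqrt_mul' _ hT.le]
  simp only [hwdef, neg_sq]
  rw [neg_add_eq_sub, hv]
  field_simp

/-- Inverts `|log K|^(-s) = o(K^(-ε))`; it reduces the hypothesis of (ii) to that of (i). -/
theorem isLittleO_rpow_abs_log_rpow {ε : ℝ} (hε : 0 < ε) (s : ℝ) :
    (fun K : ℝ => K ^ ε) =o[𝓝[>] (0 : ℝ)] (fun K : ℝ => |Real.log K| ^ s) := by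
  have hlt : ∀ᶠ K : ℝ in 𝓝[>] 0, 0 < K ∧ K < 1 := Ioo_mem_nhdsGT one_pos
  refine ((isLittleO_abs_log_rpow_rpow_nhdsGT_zero (-s) (neg_lt_zero.2 hε)).inv_rev ?_).congr'
    ?_ ?_
  · filter_upwards [hlt] with K hK h
    have := Real.rpow_pos_of_pos (abs_pos.2 (Real.log_neg hK.1 hK.2).ne) (-s)
    exact absurd h this.ne'
  · filter_upwards [hlt] with K hK
    rw [Real.rpow_neg hK.1.le, inv_inv]
  · filter_upwards with K
    rw [Real.rpow_neg (abs_nonneg _), inv_inv]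

end MassAtZero

theorem theorem1 {Ω : Type*} [MeasurableSpace Ω] (μ : Measure Ω) [IsProbabilityMeasure μ]
    (S : Ω → ℝ) (T : ℝ) (hT : 0 < T)
    (hSnonneg : ∀ᵐ ω ∂μ, 0 ≤ S ω) (hSint : Integrable S μ)
    (S₀ : ℝ) (hS₀ : S₀ = MassAtZero.spot μ S) (hS₀pos : 0 < S₀)
    (p q : ℝ) (hp : p = MassAtZero.massAtZero μ S) (hq : q = MassAtZero.stdNormalQuantile p)
    (hppos : 0 < p) :
    -- part (i)
    (((fun K : ℝ => MassAtZero.distFun μ S K - MassAtZero.distFun μ S 0)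
        =o[𝓝[>] (0 : ℝ)] (fun K : ℝ => |Real.log K| ^ (-(1 / 2) : ℝ))) →
      ∃ τ : ℝ → ℝ,
        (∀ᶠ K in 𝓝[>] (0 : ℝ),
          MassAtZero.impliedVol μ S T K
            = Real.sqrt (2 * |Real.log (K / S₀)| / T) + q / Real.sqrt T
              + 1 / Real.sqrt (2 * T * |Real.log (K / S₀)|)
                * (q ^ 2 / 2 + Real.exp (q ^ 2 / 2) * τ K)) ∧
        0 ≤ limsup (fun K : ℝ => ((τ K : ℝ) : EReal)) (𝓝[>] (0 : ℝ)) ∧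
        limsup (fun K : ℝ => ((τ K : ℝ) : EReal)) (𝓝[>] (0 : ℝ)) ≤ 1) ∧
    -- part (ii)
    (∀ ε : ℝ, 0 < ε →
      ((fun K : ℝ => MassAtZero.distFun μ S K - MassAtZero.distFun μ S 0)
        =O[𝓝[>] (0 : ℝ)] (fun K : ℝ => K ^ ε)) →
      ∃ Φ : ℝ → ℝ,
        (∀ᶠ K in 𝓝[>] (0 : ℝ),
          MassAtZero.impliedVol μ S T K
            = Real.sqrt (2 * |Real.log (K / S₀)| / T) + q / Real.sqrt T
              + q ^ 2 / (2 * Real.sqrt (2 * T * |Real.log (K / S₀)|)) + Φ K) ∧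
        limsup (fun K : ℝ =>
          ((Real.sqrt (2 * T * |Real.log (K / S₀)|) * |Φ K| : ℝ) : EReal)) (𝓝[>] (0 : ℝ)) ≤ 1) := by

  subst hS₀ hp
  have key := fun ho => MassAtZero.tendsto_impliedVol (q := q) hT hSint hSnonneg hS₀pos hppos hq ho
  have hpos : ∀ᶠ K : ℝ in 𝓝[>] (0 : ℝ),
      0 < Real.sqrt (2 * T * |Real.log (K / MassAtZero.spot μ S)|) := by
    filter_upwards [Ioo_mem_nhdsGT hS₀pos] with K hK
    have h : Real.log (K / MassAtZero.spot μ S) < 0 :=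
      Real.log_neg (div_pos hK.1 hS₀pos) ((div_lt_one hS₀pos).2 hK.2)
    have := abs_pos.2 h.ne
    positivity
  refine ⟨fun ho => ?_, fun ε hε hO => ?_⟩
  · have hA := key ho
    -- `τ` is the required expansion solved for `τ`; its limit is `e^{-q²/2} ∈ [0, 1]`.
    refine ⟨fun K => Real.exp (-(q ^ 2 / 2)) *
      (Real.sqrt (2 * T * |Real.log (K / MassAtZero.spot μ S)|) *
        (MassAtZero.impliedVol μ S T K
          - Real.sqrt (2 * |Real.log (K / MassAtZero.spot μ S)| / T) - q / Real.sqrt T)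
        - q ^ 2 / 2), ?_, ?_⟩
    · filter_upwards [hpos] with K hK
      rw [← mul_assoc (Real.exp _), ← Real.exp_add, add_neg_cancel, Real.exp_zero]
      generalize Real.sqrt (2 * T * |Real.log (K / MassAtZero.spot μ S)|) = s at hK ⊢
      field_simp
      ring
    · have hlim := (continuous_coe_real_ereal.tendsto _).comp
        ((hA.sub_const (q ^ 2 / 2)).const_mul (Real.exp (-(q ^ 2 / 2))))
      rw [add_sub_cancel_right, mul_one] at hlim
      have hls := hlim.limsup_eq
      simp only [Function.comp_def] at hls
      rw [hls]
      refine ⟨?_, ?_⟩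
      · exact_mod_cast Real.exp_nonneg _
      · exact_mod_cast Real.exp_le_one_iff.2 (by nlinarith [sq_nonneg q])
  · have hA := key (hO.trans_isLittleO (MassAtZero.isLittleO_rpow_abs_log_rpow hε _))
    refine ⟨fun K => MassAtZero.impliedVol μ S T K
      - Real.sqrt (2 * |Real.log (K / MassAtZero.spot μ S)| / T) - q / Real.sqrt T
      - q ^ 2 / (2 * Real.sqrt (2 * T * |Real.log (K / MassAtZero.spot μ S)|)),
      Eventually.of_forall fun K => by ring, ?_⟩
    -- Subtracting `q²/2` from the limit `1 + q²/2` leaves exactly `1`.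
    have h1 := (hA.sub_const (q ^ 2 / 2)).abs
    rw [add_sub_cancel_right, abs_one] at h1
    have h2 := (continuous_coe_real_ereal.tendsto _).comp h1
    refine le_of_eq ((h2.congr' ?_).limsup_eq.trans EReal.coe_one)
    filter_upwards [hpos] with K hK
    simp only [Function.comp]
    rw [← abs_of_pos hK, ← abs_mul, abs_of_pos hK]
    congr 2
    field_simp
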